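/- **Setting.** Fix a set $\mathrm{Var}$ of variables and a relational signature with equality, and a structure $\mathcal A$ with domain $A$ over it. *Formulae.* ADIF formulae are built from $\bot,\top$, atoms $R(\vec x)$ (including equality) with $\neg,\wedge,\vee$ and the quantifiers $\exists_{\pm W}x$, $\forall_{\pm W}x$, where $W\subseteq\mathrm{Var}$ is finite; put $[\![+W]\!]=W$ and $[\![-W]\!]=\mathrm{Var}\setminus W$. The meta extension adds meta-quantifiers $\boldsymbol\exists_{\pm W}x$ and $\boldsymbol\forall_{\pm W}x$. $\mathrm{sup}(\varphi)$ is the set of variables that have an occurrence in an atom of $\varphi$ not in the scope of a quantifier of any kind for that variable. A quantifier prefix $\wp$ is a finite sequence of quantifiers $Q_{\pm W}x$, $Q\in\{\exists,\forall\}$, in which every variable (i) is quantified at most once, (ii) is not in the set $[\![\pm W]\!]$ of its own quantifier, and (iii) is not quantified in the scope of a quantifier whose set $[\![\pm W]\!]$ contains it. $\mathrm{var}(\wp)$ is the set of variables quantified in $\wp$ and $\mathrm{dep}(\wp)$ the union of its sets $[\![\pm W]\!]$. The Herbrand–Skolem prefix is given by $\mathrm{hsp}(\varepsilon)=\varepsilon$,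 $\mathrm{hsp}(\wp\,\exists_{\pm W}x)=\boldsymbol\exists_{\pm W}x\;\mathrm{hsp}(\wp)$, $\mathrm{hsp}(\wp\,\forall_{\pm W}x)=\boldsymbol\forall_{\pm W}x\;\mathrm{hsp}(\wp)$. *Hyperteams.* $\mathrm{Asg}$ is the set of partial assignments $\mathrm{Var}\rightharpoonup A$. A hyperteam over $U\subseteq\mathrm{Var}$ is a set of teams, where a team is a set of assignments with domain $U$; for a hyperteam over $U$ write $\mathrm{var}(\mathfrak X)=U$ (for a hyperteam without assignments any $U$ may be taken). The dual $\overline{\mathfrak X}$ is the set of images of all functions $c:\mathfrak X\to\mathrm{Asg}$ with $c(X)\in X$ for all $X\in\mathfrak X$. $\mathrm{Fnc}_W$ is the set of $f:\mathrm{Asg}\to A$ with $f(\chi)=f(\chi{\restriction}W)$ for all $\chi$. Put $\mathrm{ext}_W(\mathfrak X,x)=\{\{\chi[x\mapsto f(\chi)]:\chi\in X\}: X\in\mathfrak X,\ f\in\mathrm{Fnc}_W\}$. *Function assignments.* A function assignment is a partial map $\mathcal F:\mathrm{Var}\rightharpoonup(\mathrm{Asg}\to A)$. It is acyclic if there is a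 partial map $\iota:\mathrm{Var}\rightharpoonup 2^{\mathrm{Var}}$ with $\mathrm{dom}\,\mathcal F\subseteq\mathrm{dom}\,\iota$ and $\mathcal F(x)\in\mathrm{Fnc}_{\iota(x)}$ for all $x\in\mathrm{dom}\,\mathcal F$, such that $x\notin\iota^*(x)$ for every $x\in\mathrm{dom}\,\iota$ (where $\iota^*(x)$ is the least set that contains $\iota(x)$ and contains $\iota(y)$ whenever $y\in\iota^*(x)\cap\mathrm{dom}\,\iota$), and such that there is no infinite sequence $x_0,x_1,\dots$ in $\mathrm{dom}\,\mathcal F$ with $x_{k+1}\in\iota(x_k)$ for all $k$ (the last condition can always be met if $\mathrm{dom}\,\mathcal F$ is finite and the others are met). For a team $X$ over $U$, $\mathrm{ext}(X,\mathcal F)$ is the set of assignments $\chi$ with domain $U\cup\mathrm{dom}\,\mathcal F$ such that $\chi{\restriction}U\in X$ and $\chi(x)=\mathcal F(x)(\chi)$ for all $x\in\mathrm{dom}\,\mathcal F\setminus U$; and $\mathrm{ext}(\mathfrak X,\mathcal F)=\{\mathrm{ext}(X,\mathcal F):X\in\mathfrak X\}$. *Semantics.* For flags $\alpha\in\{\exists\forall,\forall\exists\}$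 the relation $\mathcal A,\mathcal F,\mathfrak X\models^\alpha\varphi$ is defined by recursion on $\varphi$; $\overline\alpha$ is the other flag, and we write $\mathfrak X\models^\alpha\varphi$ while $\mathcal F$ is unchanged. - $\mathfrak X\models^{\exists\forall}\bot$ iff $\emptyset\in\mathfrak X$; $\mathfrak X\models^{\forall\exists}\bot$ iff $\mathfrak X=\emptyset$; $\mathfrak X\models^{\exists\forall}\top$ iff $\mathfrak X\ne\emptyset$; $\mathfrak X\models^{\forall\exists}\top$ iff $\emptyset\notin\mathfrak X$. - $\mathfrak X\models^{\exists\forall}R(\vec x)$ iff some $X\in\mathrm{ext}(\mathfrak X,\mathcal F)$ is such that all $\chi\in X$ satisfy $\chi(\vec x)\in R^{\mathcal A}$; $\mathfrak X\models^{\forall\exists}R(\vec x)$ iff every $X\in\mathrm{ext}(\mathfrak X,\mathcal F)$ contains some $\chi$ with $\chi(\vec x)\in R^{\mathcal A}$. - $\mathfrak X\models^\alpha\neg\varphi$ iff not $\mathfrak X\models^{\overline\alpha}\varphi$. - $\mathfrak X\models^{\exists\forall}\varphi\wedge\psi$ iff for every partition of $\mathfrak X$ into two disjoint (possibly empty) parts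 $\mathfrak X_1,\mathfrak X_2$ we have $\mathfrak X_1\models^{\exists\forall}\varphi$ or $\mathfrak X_2\models^{\exists\forall}\psi$; $\mathfrak X\models^{\forall\exists}\varphi\wedge\psi$ iff $\overline{\mathfrak X}\models^{\exists\forall}\varphi\wedge\psi$. - $\mathfrak X\models^{\forall\exists}\varphi\vee\psi$ iff for some such partition $\mathfrak X_1\models^{\forall\exists}\varphi$ and $\mathfrak X_2\models^{\forall\exists}\psi$; $\mathfrak X\models^{\exists\forall}\varphi\vee\psi$ iff $\overline{\mathfrak X}\models^{\forall\exists}\varphi\vee\psi$. - $\mathfrak X\models^{\exists\forall}\exists_{\pm W}x.\varphi$ iff $\mathrm{ext}_{[\![\pm W]\!]}(\mathfrak X,x)\models^{\exists\forall}\varphi$; $\mathfrak X\models^{\forall\exists}\exists_{\pm W}x.\varphi$ iff $\overline{\mathfrak X}\models^{\exists\forall}\exists_{\pm W}x.\varphi$. - $\mathfrak X\models^{\forall\exists}\forall_{\pm W}x.\varphi$ iff $\mathrm{ext}_{[\![\pm W]\!]}(\mathfrak X,x)\models^{\forall\exists}\varphi$; $\mathfrak X\models^{\exists\forall}\forall_{\pm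 W}x.\varphi$ iff $\overline{\mathfrak X}\models^{\forall\exists}\forall_{\pm W}x.\varphi$. - $\mathcal A,\mathcal F,\mathfrak X\models^\alpha\boldsymbol\exists_{\pm W}x.\varphi$ (respectively $\boldsymbol\forall_{\pm W}x.\varphi$) iff $\mathcal A,\mathcal F[x\mapsto f],\mathfrak X\models^\alpha\varphi$ for some (respectively all) $f\in\mathrm{Fnc}_{[\![\pm W]\!]}$. **Theorem (Herbrand–Skolem Theorem).** Let $\wp\varphi$ be an ADIF formula in prenex normal form, with quantifier prefix $\wp$ and quantifier-free matrix $\varphi$. Then $$\mathcal A,\mathcal F,\mathfrak X\models^\alpha\wp\varphi\quad\Longleftrightarrow\quad\mathcal A,\mathcal F,\mathfrak X\models^\alpha\mathrm{hsp}(\wp)\varphi$$ for both flags $\alpha\in\{\exists\forall,\forall\exists\}$, all acyclic function assignments $\mathcal F$ with $\mathrm{dom}\,\mathcal F\cap\mathrm{dep}(\wp)=\emptyset$, and all hyperteams $\mathfrak X$ with $\mathrm{sup}(\wp\varphi)\setminus\mathrm{dom}\,\mathcal F\subseteq\mathrm{var}(\mathfrak X)$ and $\mathrm{var}(\mathfrak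 X)\cap\mathrm{var}(\wp)=\emptyset$. -/

import Mathlib

namespace ADIF



universe u v w u' v'

/-- A dependence (`+W`) or independence (`-W`) constraint, with `W` a finite set of variables. -/
inductive Constraint (V : Type v) : Type v
  | dep (W : Finset V)
  | indep (W : Finset V)

/-- The set of variables denoted by a constraint: `W` for `+W`, the complement of `W` for `-W`. -/
def Constraint.denote {V : Type v} : Constraint V → Set V
  | .dep W => {x | x ∈ W}
  | .indep W => {x | x ∉ W}

/-- First-order quantifiers `∃_{±W} x` and `∀_{±W} x`. -/
inductive Quantifier (V : Type v) : Type v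
  | ex (c : Constraint V) (x : V)
  | all (c : Constraint V) (x : V)

/-- Meta quantifiers, which range over uniform Skolem functions (`eex`) and uniform Herbrand
functions (`aall`) for the variable `x`. -/
inductive MetaQuantifier (V : Type v) : Type v
  | eex (c : Constraint V) (x : V)
  | aall (c : Constraint V) (x : V)

/-- The variable that is quantified. -/
def Quantifier.bound {V : Type v} : Quantifier V → V
  | .ex _ x => x
  | .all _ x => x

/-- The dependence variables of a quantifier, i.e. the set denoted by its constraint. -/
def Quantifier.deps {V : Type v} : Quantifier V → Set V
  | .ex c _ => c.denote
  | .all c _ => c.denote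

/-- The meta quantifier that corresponds to a first-order quantifier. -/
def Quantifier.toMeta {V : Type v} : Quantifier V → MetaQuantifier V
  | .ex c x => .eex c x
  | .all c x => .aall c x

/-- Formulae of ADIF extended by the two meta quantifiers, over the relation symbols of `L`
(together with equality) and the variables in `V`. -/
inductive Formula (L : FirstOrder.Language.{u, u'}) (V : Type v) : Type (max u' v)
  | ff : Formula L V
  | tt : Formula L V
  | rel {n : ℕ} (R : L.Relations n) (xs : Fin n → V) : Formula L V
  | equal (x y : V) : Formula L V
  | neg (φ : Formula L V) : Formula L V
  | con (φ ψ : Formula L V) : Formula L V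
  | dis (φ ψ : Formula L V) : Formula L V
  | ex (c : Constraint V) (x : V) (φ : Formula L V) : Formula L V
  | all (c : Constraint V) (x : V) (φ : Formula L V) : Formula L V
  | eex (c : Constraint V) (x : V) (φ : Formula L V) : Formula L V
  | aall (c : Constraint V) (x : V) (φ : Formula L V) : Formula L V

namespace Formula

variable {L : FirstOrder.Language.{u, u'}} {V : Type v}

/-- Quantifier-free formulae (neither first-order nor meta quantifiers). -/
def QuantifierFree : Formula L V → Prop
  | ff | tt | rel _ _ | equal _ _ => True
  | neg φ => φ.QuantifierFree
  | con φ ψ | dis φ ψ => φ.QuantifierFree ∧ ψ.QuantifierFree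
  | ex _ _ _ | all _ _ _ | eex _ _ _ | aall _ _ _ => False

/-- Support variables. -/
def sup : Formula L V → Set V
  | ff | tt => ∅
  | rel _ xs => Set.range xs
  | equal x y => {x, y}
  | neg φ => φ.sup
  | con φ ψ | dis φ ψ => φ.sup ∪ ψ.sup
  | ex _ x φ | all _ x φ | eex _ x φ | aall _ x φ => φ.sup \ {x}

/-- Put one first-order quantifier in front of a formula. -/
def quantify : Quantifier V → Formula L V → Formula L V
  | .ex c x, φ => ex c x φ
  | .all c x, φ => all c x φ

/-- Put one meta quantifier in front of a formula. -/
def metaQuantify : MetaQuantifier V → Formula L V → Formula L V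
  | .eex c x, φ => eex c x φ
  | .aall c x, φ => aall c x φ

/-- The formula `℘ φ`; the head of the list is the outermost quantifier. -/
def withQuantifiers (P : List (Quantifier V)) (φ : Formula L V) : Formula L V :=
  P.foldr quantify φ

/-- A list of meta quantifiers put in front of `φ`; the head of the list is the outermost one. -/
def withMetaQuantifiers (P : List (MetaQuantifier V)) (φ : Formula L V) : Formula L V :=
  P.foldr metaQuantify φ

end Formula

/-- The admitted quantifier prefixes: every variable is quantified at most once, it does not occur
in the constraint set of its own quantifier, and it is not quantified in the scope of a quantifier
whose constraint set contains it. -/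
structure IsQuantifierPrefix {V : Type v} (P : List (Quantifier V)) : Prop where
  nodup : (P.map Quantifier.bound).Nodup
  not_self : ∀ q ∈ P, q.bound ∉ q.deps
  not_inner : P.Pairwise (fun q r => r.bound ∉ q.deps)

/-- The variables quantified in a prefix. -/
def prefixVars {V : Type v} (P : List (Quantifier V)) : Set V := {x | ∃ q ∈ P, q.bound = x}

/-- The dependence variables of a prefix: the union of all its constraint sets. -/
def prefixDeps {V : Type v} (P : List (Quantifier V)) : Set V := {x | ∃ q ∈ P, x ∈ q.deps}

/-- The Herbrand-Skolem prefix: every quantifier becomes the corresponding meta quantifier and the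
order is reversed. -/
def hsp {V : Type v} (P : List (Quantifier V)) : List (MetaQuantifier V) :=
  (P.map Quantifier.toMeta).reverse

/-- Partial assignments of elements of the domain `A` to variables. -/
abbrev Asg (V : Type v) (A : Type w) := V → Option A

/-- Teams: sets of assignments (with a common domain, see `IsHyperteam`). -/
abbrev Team (V : Type v) (A : Type w) := Set (Asg V A)

/-- Hyperteams: sets of teams (with a common domain, see `IsHyperteam`). -/
abbrev Hyperteam (V : Type v) (A : Type w) := Set (Team V A)

/-- Skolem/Herbrand functions. -/
abbrev Fnc (V : Type v) (A : Type w) := Asg V A → A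

/-- Function assignments: partial maps from variables to functions. -/
abbrev FunAsg (V : Type v) (A : Type w) := V → Option (Fnc V A)

/-- Dependency contexts: partial maps from variables to sets of variables. -/
abbrev DepCtx (V : Type v) := V → Option (Set V)

/-- Domain of a partial map. -/
def pdom {V : Type v} {B : Type w} (f : V → Option B) : Set V := {x | ∃ b, f x = some b}

/-- The partial map `f[x ↦ b]`. -/
noncomputable def pupdate {V : Type v} {B : Type w} (f : V → Option B) (x : V) (b : B) :
    V → Option B :=
  open Classical in fun y => if y = x then some b else f y

/-- Restriction of a partial map to `dom f ∩ W`. -/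
noncomputable def prestrict {V : Type v} {B : Type w} (f : V → Option B) (W : Set V) :
    V → Option B :=
  open Classical in fun y => if y ∈ W then f y else none

/-- `X` is a hyperteam over the set of variables `U`. -/
def IsHyperteam {V : Type v} {A : Type w} (U : Set V) (X : Hyperteam V A) : Prop :=
  ∀ T ∈ X, ∀ χ ∈ T, pdom χ = U

/-- `W`-uniform functions. -/
def Uniform {V : Type v} {A : Type w} (W : Set V) (f : Fnc V A) : Prop :=
  ∀ χ : Asg V A, f χ = f (prestrict χ W)

/-- `ι.Closure x y` says that `y` belongs to `ι*(x)`, where `ι*` is the transitive closure of the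
dependency context `ι`. -/
inductive DepCtx.Closure {V : Type v} (ι : DepCtx V) (x : V) : V → Prop
  | base {S : Set V} {y : V} (hS : ι x = some S) (hy : y ∈ S) : DepCtx.Closure ι x y
  | step {S : Set V} {y z : V} (h : DepCtx.Closure ι x y) (hS : ι y = some S) (hz : z ∈ S) :
      DepCtx.Closure ι x z

/-- Acyclic dependency contexts. -/
def DepCtx.Acyclic {V : Type v} (ι : DepCtx V) : Prop :=
  ∀ x ∈ pdom ι, ¬ DepCtx.Closure ι x x

/-- The functions stored in `F` respect the dependency context `ι`: the domain of `ι` contains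
that of `F`, and `F(x)` is `ι(x)`-uniform for every `x` in the domain of `F`. -/
def FunAsg.Respects {V : Type v} {A : Type w} (F : FunAsg V A) (ι : DepCtx V) : Prop :=
  ∀ x f, F x = some f → ∃ S, ι x = some S ∧ Uniform S f

/-- There is no infinite chain `x₀, x₁, x₂, …` in the domain of `F` with `xₖ₊₁ ∈ ι(xₖ)` for all
`k`. -/
def FunAsg.Grounded {V : Type v} {A : Type w} (F : FunAsg V A) (ι : DepCtx V) : Prop :=
  WellFounded (fun y x : V => x ∈ pdom F ∧ y ∈ pdom F ∧ ∃ S, ι x = some S ∧ y ∈ S)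

/-- Acyclic function assignments. When the domain of `F` is finite, the clause `F.Grounded ι`
follows from the acyclicity of `ι`; in general it excludes infinite descending dependency chains,
so that each assignment has exactly one extension by `F`. -/
def FunAsg.Acyclic {V : Type v} {A : Type w} (F : FunAsg V A) : Prop :=
  ∃ ι : DepCtx V, ι.Acyclic ∧ F.Respects ι ∧ F.Grounded ι

/-- Extension of a team by a function for the variable `x`. -/
noncomputable def Team.ext {V : Type v} {A : Type w} (T : Team V A) (f : Fnc V A) (x : V) :
    Team V A :=
  {χ' | ∃ χ ∈ T, χ' = pupdate χ x (f χ)}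

/-- `W`-uniform extension of a hyperteam with the variable `x`. -/
def Hyperteam.ext {V : Type v} {A : Type w} (W : Set V) (X : Hyperteam V A) (x : V) :
    Hyperteam V A :=
  {T' | ∃ T ∈ X, ∃ f : Fnc V A, Uniform W f ∧ T' = Team.ext T f x}

/-- The dual hyperteam: the images of all choice functions of `X`. -/
def Hyperteam.dual {V : Type v} {A : Type w} (X : Hyperteam V A) : Hyperteam V A :=
  {T' | ∃ c : Team V A → Asg V A, (∀ T ∈ X, c T ∈ T) ∧ T' = c '' X}

/-- `(X₁, X₂)` is a bipartition of `X`. -/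
def Hyperteam.IsPartition {V : Type v} {A : Type w} (X X₁ X₂ : Hyperteam V A) : Prop :=
  X₁ ∩ X₂ = ∅ ∧ X₁ ∪ X₂ = X

/-- Extension of a team by a function assignment. The extensions of `χ ∈ T` are the assignments
`χ'` with domain `dom χ ∪ dom F` that agree with `χ` on `dom χ` and satisfy `χ'(x) = F(x)(χ')` for
all `x ∈ dom F \ dom χ`. -/
def Team.extFun {V : Type v} {A : Type w} (T : Team V A) (F : FunAsg V A) : Team V A :=
  {χ' | ∃ χ ∈ T, pdom χ' = pdom χ ∪ pdom F ∧ (∀ x ∈ pdom χ, χ' x = χ x) ∧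
    ∀ x f, x ∉ pdom χ → F x = some f → χ' x = some (f χ')}

/-- Extension of a hyperteam by a function assignment. -/
def Hyperteam.extFun {V : Type v} {A : Type w} (X : Hyperteam V A) (F : FunAsg V A) :
    Hyperteam V A :=
  {T' | ∃ T ∈ X, T' = Team.extFun T F}

/-- Alternation flags. -/
inductive Flag : Type
  | EA
  | AE

/-- The dual flag. -/
def Flag.dual : Flag → Flag
  | .EA => .AE
  | .AE => .EA

/-- The tuple `xs` is in the domain of `χ` and its value belongs to the relation `R`. -/
def HoldsRel {L : FirstOrder.Language.{u, u'}} {V : Type v} {A : Type w} [L.Structure A] {n : ℕ}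
    (R : L.Relations n) (xs : Fin n → V) (χ : Asg V A) : Prop :=
  ∃ a : Fin n → A, (∀ i, χ (xs i) = some (a i)) ∧ FirstOrder.Language.Structure.RelMap R a

/-- `x` and `y` are in the domain of `χ` and have the same value. -/
def HoldsEqual {V : Type v} {A : Type w} (x y : V) (χ : Asg V A) : Prop :=
  ∃ a : A, χ x = some a ∧ χ y = some a

/-- The condition for an atom whose truth at an assignment is given by `p`, under a flag. -/
def atomSat {V : Type v} {A : Type w} (p : Asg V A → Prop) (X : Hyperteam V A) : Flag → Prop
  | .EA => ∃ T ∈ X, ∀ χ ∈ T, p χ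
  | .AE => ∀ T ∈ X, ∃ χ ∈ T, p χ

/-- Hodges' alternating semantic relation `A, F, X ⊨^α φ`. For a connective or quantifier under
the flag that is not its own, the usual rule passes to the dual hyperteam and the dual flag
with the same formula; here that rule is already unfolded once. -/
def Sat {L : FirstOrder.Language.{u, u'}} {V : Type v} {A : Type w} [L.Structure A] :
    Formula L V → FunAsg V A → Hyperteam V A → Flag → Prop
  | .ff, _, X, .EA => ∅ ∈ X
  | .ff, _, X, .AE => X = ∅
  | .tt, _, X, .EA => X ≠ ∅
  | .tt, _, X, .AE => ∅ ∉ X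
  | .rel R xs, F, X, α => atomSat (HoldsRel R xs) (X.extFun F) α
  | .equal x y, F, X, α => atomSat (HoldsEqual x y) (X.extFun F) α
  | .neg φ, F, X, α => ¬ Sat φ F X α.dual
  | .con φ ψ, F, X, .EA => ∀ X₁ X₂, X.IsPartition X₁ X₂ → Sat φ F X₁ .EA ∨ Sat ψ F X₂ .EA
  | .con φ ψ, F, X, .AE => ∀ X₁ X₂, X.dual.IsPartition X₁ X₂ → Sat φ F X₁ .EA ∨ Sat ψ F X₂ .EA
  | .dis φ ψ, F, X, .EA => ∃ X₁ X₂, X.dual.IsPartition X₁ X₂ ∧ Sat φ F X₁ .AE ∧ Sat ψ F X₂ .AE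
  | .dis φ ψ, F, X, .AE => ∃ X₁ X₂, X.IsPartition X₁ X₂ ∧ Sat φ F X₁ .AE ∧ Sat ψ F X₂ .AE
  | .ex c x φ, F, X, .EA => Sat φ F (X.ext c.denote x) .EA
  | .ex c x φ, F, X, .AE => Sat φ F (X.dual.ext c.denote x) .EA
  | .all c x φ, F, X, .EA => Sat φ F (X.dual.ext c.denote x) .AE
  | .all c x φ, F, X, .AE => Sat φ F (X.ext c.denote x) .AE
  | .eex c x φ, F, X, α => ∃ f : Fnc V A, Uniform c.denote f ∧ Sat φ (pupdate F x f) X α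
  | .aall c x φ, F, X, α => ∀ f : Fnc V A, Uniform c.denote f → Sat φ (pupdate F x f) X α

end ADIF

namespace ADIF

variable {V A : Type*}

/-! Both sides reduce to the same string of quantifiers over uniform functions, in front of one
condition `atomSat` on the original hyperteam.

For acyclic `F` every assignment `χ` has a unique extension `e χ`. A quantifier-free matrix is
evaluated pointwise at `e χ` (`sat_iff_atomSat_holds`), because `atomSat` does not notice that
hyperteam and flag are dualised together (`atomSat_dual`). Extending a hyperteam by `x` then amounts
to quantifying over `f` and pulling the predicate back along `χ ↦ χ[x ↦ f χ]`. Extensions are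
unwound from the last one made, that of the innermost quantifier, so its function is quantified
first; this reverses the prefix (`prefixEval`, `sat_withQuantifiers_iff`).

On the meta side, storing `f` in `F` replaces `e χ` by `e (χ[x ↦ f χ])` for `χ` undefined at `x`,
since `f` depends neither on `x` nor on `pdom F` (`IsExtension.of_pupdate`). Induction from the
inner end of the prefix gives the same `prefixEval` (`sat_hsp_iff`). -/

/-- The constraint of a quantifier together with its kind, as a quantification over functions. -/
def Quantifier.functions (q : Quantifier V) (k : Fnc V A → Prop) : Prop :=
  match q with
  | .ex c _ => ∃ f : Fnc V A, Uniform c.denote f ∧ k f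
  | .all c _ => ∀ f : Fnc V A, Uniform c.denote f → k f

theorem Quantifier.functions_congr (q : Quantifier V) {k k' : Fnc V A → Prop}
    (h : ∀ f, Uniform q.deps f → (k f ↔ k' f)) : q.functions k ↔ q.functions k' := by
  cases q with
  | ex c x => exact exists_congr fun f => and_congr_right fun hf => h f hf
  | all c x => exact forall_congr' fun f => forall_congr' fun hf => h f hf

section PartialMaps

variable {B : Type*}

theorem mem_pdom {f : V → Option B} {x : V} : x ∈ pdom f ↔ f x ≠ none := by
  simp [pdom, Option.ne_none_iff_exists']

theorem pupdate_self (f : V → Option B) (x : V) (b : B) : pupdate f x b x = some b := by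
  simp [pupdate]

theorem pupdate_of_ne (f : V → Option B) {x y : V} (b : B) (h : y ≠ x) :
    pupdate f x b y = f y := by
  simp [pupdate, h]

theorem pdom_pupdate (f : V → Option B) (x : V) (b : B) :
    pdom (pupdate f x b) = insert x (pdom f) := by
  ext y
  by_cases h : y = x
  · subst h; simp [mem_pdom, pupdate_self]
  · simp [mem_pdom, pupdate_of_ne, h]

end PartialMaps

theorem Uniform.congr {W : Set V} {f : Fnc V A} (hf : Uniform W f) {χ χ' : Asg V A}
    (h : ∀ y ∈ W, χ y = χ' y) : f χ = f χ' := by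
  rw [hf χ, hf χ']
  congr 1
  funext y
  by_cases hy : y ∈ W <;> simp [prestrict, hy, h]

/-! ### Unique extension along an acyclic function assignment -/

/-- `χ'` is an extension of the assignment `χ` by the function assignment `F`. -/
def IsExtension (F : FunAsg V A) (χ χ' : Asg V A) : Prop :=
  pdom χ' = pdom χ ∪ pdom F ∧ (∀ x ∈ pdom χ, χ' x = χ x) ∧
    ∀ x f, x ∉ pdom χ → F x = some f → χ' x = some (f χ')

/-- Well-founded induction along dependencies: by uniformity a value at `x` is determined by those
at `ι x`, and outside `pdom F` the values come from `χ` alone. -/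
theorem IsExtension.eq {F : FunAsg V A} {ι : DepCtx V} (hι : F.Respects ι) (hg : F.Grounded ι)
    {χ χ₁ χ₂ : Asg V A} (h₁ : IsExtension F χ χ₁) (h₂ : IsExtension F χ χ₂) : χ₁ = χ₂ := by
  have outside : ∀ x, x ∉ pdom F → χ₁ x = χ₂ x := by
    intro x hx
    by_cases hχ : x ∈ pdom χ
    · rw [h₁.2.1 x hχ, h₂.2.1 x hχ]
    · have n₁ : x ∉ pdom χ₁ := by rw [h₁.1]; simp [hχ, hx]
      have n₂ : x ∉ pdom χ₂ := by rw [h₂.1]; simp [hχ, hx]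
      rw [mem_pdom, not_not] at n₁ n₂
      rw [n₁, n₂]
  funext x
  induction x using hg.induction with
  | _ x ih =>
    by_cases hF : x ∈ pdom F
    · by_cases hχ : x ∈ pdom χ
      · rw [h₁.2.1 x hχ, h₂.2.1 x hχ]
      · obtain ⟨f, hf⟩ := id hF
        obtain ⟨S, hS, hu⟩ := hι x f hf
        rw [h₁.2.2 x f hχ hf, h₂.2.2 x f hχ hf]
        refine congrArg some (hu.congr fun y hy => ?_)
        by_cases hyF : y ∈ pdom F
        · exact ih y ⟨hF, hyF, S, hS, hy⟩
        · exact outside y hyF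
    · exact outside x hF

theorem exists_isExtension {F : FunAsg V A} {ι : DepCtx V} (hι : F.Respects ι)
    (hg : F.Grounded ι) (χ : Asg V A) : ∃ χ', IsExtension F χ χ' := by
  classical
  -- The argument passed to `f` is correct only on the dependencies of `x`: recursive values inside
  -- `pdom F`, values of `χ` outside. Elsewhere uniformity makes it irrelevant.
  let step (x : V) (rec : ∀ y, (x ∈ pdom F ∧ y ∈ pdom F ∧ ∃ S, ι x = some S ∧ y ∈ S) → Option A) :
      Option A :=
    if x ∈ pdom χ then χ x
    else (F x).map fun f => f fun y =>
      if h : x ∈ pdom F ∧ y ∈ pdom F ∧ ∃ S, ι x = some S ∧ y ∈ S then rec y h else χ y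
  let χ' : Asg V A := hg.fix (C := fun _ => Option A) step
  have unfold : ∀ x, χ' x = step x fun y _ => χ' y := fun x => hg.fix_eq step x
  have inside : ∀ x ∈ pdom χ, χ' x = χ x := by
    intro x hx
    rw [unfold x]
    exact if_pos hx
  have outside : ∀ x, x ∉ pdom F → χ' x = χ x := by
    intro x hx
    by_cases hχ : x ∈ pdom χ
    · exact inside x hχ
    · rw [unfold x]
      rw [mem_pdom, not_not] at hx
      have hχ' := hχ
      rw [mem_pdom, not_not] at hχ'
      simp [step, hχ, hx, hχ']
  have value : ∀ x f, x ∉ pdom χ → F x = some f → χ' x = some (f χ') := by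
    intro x f hχ hf
    obtain ⟨S, hS, hu⟩ := hι x f hf
    rw [unfold x]
    simp only [step, if_neg hχ, hf, Option.map_some]
    refine congrArg some (hu.congr fun y hy => ?_)
    by_cases hyF : y ∈ pdom F
    · exact dif_pos ⟨⟨f, hf⟩, hyF, S, hS, hy⟩
    · rw [dif_neg fun h => hyF h.2.1, outside y hyF]
  refine ⟨χ', ?_, inside, value⟩
  ext x
  by_cases hχ : x ∈ pdom χ
  · simp only [Set.mem_union, hχ, true_or, iff_true]
    rw [mem_pdom, inside x hχ]
    exact mem_pdom.1 hχ
  · by_cases hF : x ∈ pdom F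
    · obtain ⟨f, hf⟩ := id hF
      simp only [Set.mem_union, hF, or_true, iff_true]
      exact ⟨_, value x f hχ hf⟩
    · simp only [Set.mem_union, hχ, hF, or_self, iff_false]
      rw [mem_pdom, outside x hF]
      exact fun h => hχ (mem_pdom.2 h)

/-- An acyclic function assignment extends every assignment in exactly one way. -/
theorem FunAsg.Acyclic.exists_extension {F : FunAsg V A} (hF : F.Acyclic) :
    ∃ e : Asg V A → Asg V A, ∀ χ χ', IsExtension F χ χ' ↔ χ' = e χ := by
  obtain ⟨ι, -, hι, hg⟩ := hF
  choose e he using exists_isExtension hι hg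
  exact ⟨e, fun χ χ' => ⟨fun h => h.eq hι hg (he χ), fun h => h ▸ he χ⟩⟩

/-- Acyclicity is kept when a function is added that depends on no function variable. -/
theorem FunAsg.Acyclic.pupdate {F : FunAsg V A} (hF : F.Acyclic) {W : Set V} {x : V}
    {f : Fnc V A} (hf : Uniform W f) (hx : x ∉ W) (hW : ∀ y ∈ W, y ∉ pdom F) :
    FunAsg.Acyclic (ADIF.pupdate F x f) := by
  classical
  obtain ⟨ι, hac, hι, hg⟩ := hF
  -- Restricting `ι` to `pdom F` leaves `κ` undefined on `W`, so every dependency path that passes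
  -- through `x` stops one step later.
  let κ : DepCtx V := ADIF.pupdate (prestrict ι (pdom F)) x W
  have κ_self : κ x = some W := pupdate_self _ _ _
  have κ_of_ne : ∀ y, y ≠ x → ∀ S, κ y = some S → y ∈ pdom F ∧ ι y = some S := by
    intro y hy S hS
    simp only [κ, pupdate_of_ne _ _ hy, prestrict] at hS
    split_ifs at hS with h
    exact ⟨h, hS⟩
  have dead : ∀ y ∈ W, ∀ S, κ y ≠ some S := by
    intro y hy S hS
    exact hW y hy (κ_of_ne y (fun h => hx (h ▸ hy)) S hS).1
  have closure_self : ∀ y, DepCtx.Closure κ x y → y ∈ W := by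
    intro y h
    induction h with
    | base hS hy =>
      rw [κ_self, Option.some_inj] at hS
      exact hS ▸ hy
    | step _ hS _ ih => exact absurd hS (dead _ ih _)
  have closure_of_ne : ∀ z, z ≠ x → ∀ y, DepCtx.Closure κ z y →
      DepCtx.Closure ι z y ∨ y ∈ W := by
    intro z hz y h
    induction h with
    | base hS hy => exact .inl (.base (κ_of_ne _ hz _ hS).2 hy)
    | @step S y w _ hS hw ih =>
      by_cases hy : y = x
      · subst hy
        rw [κ_self, Option.some_inj] at hS
        exact .inr (hS ▸ hw)
      · rcases ih with ih | ih
        · exact .inl (.step ih (κ_of_ne _ hy _ hS).2 hw)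
        · exact absurd hS (dead _ ih _)
  refine ⟨κ, ?_, ?_, ?_⟩
  · rintro y ⟨S, hS⟩ hy
    by_cases hyx : y = x
    · subst hyx
      exact hx (closure_self _ hy)
    · rcases closure_of_ne y hyx y hy with h | h
      · exact hac y ⟨S, (κ_of_ne y hyx S hS).2⟩ h
      · exact dead y h S hS
  · intro y g hg'
    by_cases hyx : y = x
    · subst hyx
      rw [pupdate_self, Option.some_inj] at hg'
      exact ⟨W, κ_self, hg' ▸ hf⟩
    · rw [pupdate_of_ne _ _ hyx] at hg'
      obtain ⟨S, hS, hu⟩ := hι y g hg'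
      refine ⟨S, ?_, hu⟩
      have : y ∈ pdom F := ⟨g, hg'⟩
      simp [κ, pupdate_of_ne _ _ hyx, prestrict, this, hS]
  · have acc_of_mem : ∀ y ∈ W, Acc (fun y z : V => z ∈ pdom (ADIF.pupdate F x f) ∧
        y ∈ pdom (ADIF.pupdate F x f) ∧ ∃ S, κ z = some S ∧ y ∈ S) y :=
      fun y hy => ⟨_, fun z ⟨_, _, S, hS, _⟩ => absurd hS (dead y hy S)⟩
    have acc_self : Acc (fun y z : V => z ∈ pdom (ADIF.pupdate F x f) ∧
        y ∈ pdom (ADIF.pupdate F x f) ∧ ∃ S, κ z = some S ∧ y ∈ S) x := by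
      refine ⟨_, fun z ⟨_, _, S, hS, hz⟩ => acc_of_mem z ?_⟩
      rw [κ_self, Option.some_inj] at hS
      exact hS ▸ hz
    refine ⟨fun y => ?_⟩
    induction y using hg.induction with
    | _ y ih =>
      by_cases hyx : y = x
      · exact hyx ▸ acc_self
      · refine ⟨_, fun z ⟨_, hzF, S, hS, hz⟩ => ?_⟩
        by_cases hzx : z = x
        · exact hzx ▸ acc_self
        · rw [pdom_pupdate] at hzF
          have hy := κ_of_ne y hyx S hS
          exact ih z ⟨hy.1, hzF.resolve_left hzx, S, hy.2, hz⟩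

/-! ### The atom condition under dualisation, connectives and extension -/

section AtomSat

variable {p q : Asg V A → Prop} {X : Hyperteam V A}

/-- This is the axiom of choice: picking from every team an assignment with `p` (or,
contrapositively, without it) is the same as exhibiting a choice image. -/
theorem atomSat_dual (p : Asg V A → Prop) (X : Hyperteam V A) (α : Flag) :
    atomSat p X.dual α ↔ atomSat p X α.dual := by
  classical
  cases α with
  | EA =>
    constructor
    · rintro ⟨_, ⟨c, hc, rfl⟩, h⟩ T hT
      exact ⟨c T, hc T hT, h _ ⟨T, hT, rfl⟩⟩
    · intro h
      choose c hc hp using h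
      -- Outside `X` the choice function is arbitrary; the empty assignment serves as default.
      refine ⟨_, ⟨fun T => if hT : T ∈ X then c T hT else fun _ => none, ?_, rfl⟩, ?_⟩
      · intro T hT
        simpa [hT] using hc T hT
      · rintro _ ⟨T, hT, rfl⟩
        simpa [hT] using hp T hT
  | AE =>
    constructor
    · intro h
      by_contra hn
      simp only [Flag.dual, atomSat] at hn
      push Not at hn
      choose c hc hp using hn
      obtain ⟨_, ⟨T, hT, rfl⟩, h'⟩ :=
        h _ ⟨fun T => if hT : T ∈ X then c T hT else fun _ => none, fun T hT => by
          simpa [hT] using hc T hT, rfl⟩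
      simp only [hT, dif_pos] at h'
      exact hp T hT h'
    · rintro ⟨T, hT, h⟩ _ ⟨c, hc, rfl⟩
      exact ⟨c T, ⟨T, hT, rfl⟩, h _ (hc T hT)⟩

theorem not_atomSat_dual (p : Asg V A → Prop) (X : Hyperteam V A) (α : Flag) :
    ¬ atomSat p X α.dual ↔ atomSat (fun χ => ¬ p χ) X α := by
  cases α <;> simp [atomSat, Flag.dual]

theorem atomSat_and :
    (∀ X₁ X₂, X.IsPartition X₁ X₂ → atomSat p X₁ .EA ∨ atomSat q X₂ .EA) ↔
      atomSat (fun χ => p χ ∧ q χ) X .EA := by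
  constructor
  · intro h
    -- The critical partition: no team of the first part can witness `p`, so a team of the second
    -- part satisfies `q` as well.
    have hX : X.IsPartition {T ∈ X | ¬ ∀ χ ∈ T, p χ} {T ∈ X | ∀ χ ∈ T, p χ} :=
      ⟨by ext T; simp only [Set.mem_inter_iff, Set.mem_ofPred_eq, Set.mem_empty_iff_false]; tauto,
        by ext T; simp only [Set.mem_union, Set.mem_ofPred_eq]; tauto⟩
    rcases h _ _ hX with ⟨T, hT, hp⟩ | ⟨T, hT, hq⟩
    · exact absurd hp hT.2
    · exact ⟨T, hT.1, fun χ hχ => ⟨hT.2 χ hχ, hq χ hχ⟩⟩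
  · rintro ⟨T, hT, h⟩ X₁ X₂ ⟨-, rfl⟩
    exact hT.imp (fun hT => ⟨T, hT, fun χ hχ => (h χ hχ).1⟩)
      fun hT => ⟨T, hT, fun χ hχ => (h χ hχ).2⟩

theorem atomSat_or :
    (∃ X₁ X₂, X.IsPartition X₁ X₂ ∧ atomSat p X₁ .AE ∧ atomSat q X₂ .AE) ↔
      atomSat (fun χ => p χ ∨ q χ) X .AE := by
  constructor
  · rintro ⟨X₁, X₂, ⟨-, rfl⟩, h₁, h₂⟩ T (hT | hT)
    · exact (h₁ T hT).imp fun χ h => ⟨h.1, .inl h.2⟩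
    · exact (h₂ T hT).imp fun χ h => ⟨h.1, .inr h.2⟩
  · intro h
    refine ⟨{T ∈ X | ∃ χ ∈ T, p χ}, {T ∈ X | ¬ ∃ χ ∈ T, p χ}, ⟨?_, ?_⟩, fun T hT => hT.2, ?_⟩
    · exact Set.eq_empty_of_forall_notMem fun T hT => hT.2.2 hT.1.2
    · exact Set.ext fun T => ⟨fun hT => hT.elim And.left And.left,
        fun hT => (em (∃ χ ∈ T, p χ)).imp (⟨hT, ·⟩) (⟨hT, ·⟩)⟩
    · rintro T ⟨hT, hn⟩
      obtain ⟨χ, hχ, hp | hq⟩ := h T hT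
      · exact absurd ⟨χ, hχ, hp⟩ hn
      · exact ⟨χ, hχ, hq⟩

theorem atomSat_extFun {F : FunAsg V A} {e : Asg V A → Asg V A}
    (he : ∀ χ χ', IsExtension F χ χ' ↔ χ' = e χ) (p : Asg V A → Prop) (X : Hyperteam V A)
    (α : Flag) : atomSat p (X.extFun F) α ↔ atomSat (fun χ => p (e χ)) X α := by
  have mem : ∀ (T : Team V A) χ', χ' ∈ T.extFun F ↔ ∃ χ ∈ T, χ' = e χ := fun T χ' =>
    exists_congr fun χ => and_congr_right fun _ => he χ χ'
  cases α with
  | EA =>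
    constructor
    · rintro ⟨_, ⟨T, hT, rfl⟩, h⟩
      exact ⟨T, hT, fun χ hχ => h _ ((mem T _).2 ⟨χ, hχ, rfl⟩)⟩
    · rintro ⟨T, hT, h⟩
      refine ⟨_, ⟨T, hT, rfl⟩, fun χ' hχ' => ?_⟩
      obtain ⟨χ, hχ, rfl⟩ := (mem T χ').1 hχ'
      exact h χ hχ
  | AE =>
    constructor
    · intro h T hT
      obtain ⟨χ', hχ', hp⟩ := h _ ⟨T, hT, rfl⟩
      obtain ⟨χ, hχ, rfl⟩ := (mem T χ').1 hχ'
      exact ⟨χ, hχ, hp⟩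
    · rintro h _ ⟨T, hT, rfl⟩
      obtain ⟨χ, hχ, hp⟩ := h T hT
      exact ⟨e χ, (mem T _).2 ⟨χ, hχ, rfl⟩, hp⟩

/-- Under this flag both team and function are chosen existentially, so the function can be pulled
out in front. -/
theorem atomSat_ext_EA (W : Set V) (x : V) :
    atomSat p (X.ext W x) .EA ↔
      ∃ f, Uniform W f ∧ atomSat (fun χ => p (pupdate χ x (f χ))) X .EA := by
  constructor
  · rintro ⟨_, ⟨T, hT, f, hf, rfl⟩, h⟩
    exact ⟨f, hf, T, hT, fun χ hχ => h _ ⟨χ, hχ, rfl⟩⟩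
  · rintro ⟨f, hf, T, hT, h⟩
    refine ⟨_, ⟨T, hT, f, hf, rfl⟩, ?_⟩
    rintro _ ⟨χ, hχ, rfl⟩
    exact h χ hχ

theorem atomSat_ext_AE (W : Set V) (x : V) :
    atomSat p (X.ext W x) .AE ↔
      ∀ f, Uniform W f → atomSat (fun χ => p (pupdate χ x (f χ))) X .AE := by
  constructor
  · intro h f hf T hT
    obtain ⟨_, ⟨χ, hχ, rfl⟩, hp⟩ := h _ ⟨T, hT, f, hf, rfl⟩
    exact ⟨χ, hχ, hp⟩
  · rintro h _ ⟨T, hT, f, hf, rfl⟩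
    obtain ⟨χ, hχ, hp⟩ := h f hf T hT
    exact ⟨_, ⟨χ, hχ, rfl⟩, hp⟩

theorem atomSat_congr {U : Set V} (hX : IsHyperteam U X)
    (h : ∀ χ, pdom χ = U → (p χ ↔ q χ)) (α : Flag) : atomSat p X α ↔ atomSat q X α := by
  cases α with
  | EA =>
    exact exists_congr fun T => and_congr_right fun hT => forall_congr' fun χ =>
      forall_congr' fun hχ => h χ (hX T hT χ hχ)
  | AE =>
    exact forall_congr' fun T => forall_congr' fun hT => exists_congr fun χ =>
      and_congr_right fun hχ => h χ (hX T hT χ hχ)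

end AtomSat

/-! ### Evaluation of matrices and prefixes -/

section Formulae

variable {L : FirstOrder.Language} [L.Structure A]

/-- Classical truth of a quantifier-free formula at an assignment. -/
def Formula.Holds : Formula L V → Asg V A → Prop
  | .ff, _ => False
  | .tt, _ => True
  | .rel R xs, χ => HoldsRel R xs χ
  | .equal x y, χ => HoldsEqual x y χ
  | .neg φ, χ => ¬ φ.Holds χ
  | .con φ ψ, χ => φ.Holds χ ∧ ψ.Holds χ
  | .dis φ ψ, χ => φ.Holds χ ∨ ψ.Holds χ
  | .ex _ _ _, _ | .all _ _ _, _ | .eex _ _ _, _ | .aall _ _ _, _ => False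

/-- Quantifier-free formulae are evaluated pointwise on the extensions of the assignments. -/
theorem sat_iff_atomSat_holds {φ : Formula L V} (hφ : φ.QuantifierFree) {F : FunAsg V A}
    {e : Asg V A → Asg V A} (he : ∀ χ χ', IsExtension F χ χ' ↔ χ' = e χ)
    (X : Hyperteam V A) (α : Flag) :
    Sat φ F X α ↔ atomSat (fun χ => φ.Holds (e χ)) X α := by
  induction φ generalizing X α with
  | ff =>
    cases α with
    | EA => simp [Sat, atomSat, Formula.Holds, ← Set.eq_empty_iff_forall_notMem]
    | AE => simp [Sat, atomSat, Formula.Holds, ← Set.eq_empty_iff_forall_notMem]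
  | tt =>
    cases α with
    | EA => simp [Sat, atomSat, Formula.Holds, ← Set.nonempty_iff_ne_empty, Set.Nonempty]
    | AE =>
      simp only [Sat, atomSat, Formula.Holds, and_true]
      constructor
      · intro h T hT
        exact Set.nonempty_iff_ne_empty.2 fun h' => h (h' ▸ hT)
      · intro h hT
        obtain ⟨χ, hχ⟩ := h ∅ hT
        exact hχ
  | rel R xs => cases α <;> exact atomSat_extFun he _ X _
  | equal x y => cases α <;> exact atomSat_extFun he _ X _
  | neg φ ih =>
    have h : Sat φ.neg F X α ↔ ¬ Sat φ F X α.dual := by cases α <;> rfl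
    rw [h, ih hφ, not_atomSat_dual]
    rfl
  | con φ ψ ih₁ ih₂ =>
    -- Stated for all `Y` so that it serves `X` under one flag and `X.dual` under the other.
    have h : ∀ Y : Hyperteam V A,
        (∀ X₁ X₂, Y.IsPartition X₁ X₂ → Sat φ F X₁ .EA ∨ Sat ψ F X₂ .EA) ↔
          atomSat (fun χ => (φ.con ψ).Holds (e χ)) Y .EA := by
      intro Y
      simp only [ih₁ hφ.1, ih₂ hφ.2]
      exact atomSat_and
    cases α with
    | EA => exact h X
    | AE => exact (h X.dual).trans (atomSat_dual _ X .EA)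
  | dis φ ψ ih₁ ih₂ =>
    have h : ∀ Y : Hyperteam V A,
        (∃ X₁ X₂, Y.IsPartition X₁ X₂ ∧ Sat φ F X₁ .AE ∧ Sat ψ F X₂ .AE) ↔
          atomSat (fun χ => (φ.dis ψ).Holds (e χ)) Y .AE := by
      intro Y
      simp only [ih₁ hφ.1, ih₂ hφ.2]
      exact atomSat_or
    cases α with
    | EA => exact (h X.dual).trans (atomSat_dual _ X .AE)
    | AE => exact h X
  | ex | all | eex | aall => exact hφ.elim

/-- The function quantifications that correspond to a prefix, the innermost quantifier coming
first, in front of a property `k` of predicates on assignments. -/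
def prefixEval : List (Quantifier V) → ((Asg V A → Prop) → Prop) → (Asg V A → Prop) → Prop
  | [], k => k
  | q :: P, k => prefixEval P fun p =>
      q.functions fun f => k fun χ => p (pupdate χ q.bound (f χ))

theorem prefixEval_concat (P : List (Quantifier V)) (q : Quantifier V)
    (k : (Asg V A → Prop) → Prop) (p : Asg V A → Prop) :
    prefixEval (P ++ [q]) k p ↔
      q.functions fun f => prefixEval P k fun χ => p (pupdate χ q.bound (f χ)) := by
  induction P generalizing k with
  | nil => rfl
  | cons r P ih => exact ih _

theorem prefixEval_congr (P : List (Quantifier V)) {k k' : (Asg V A → Prop) → Prop}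
    (h : ∀ p, k p ↔ k' p) : ∀ p, prefixEval P k p ↔ prefixEval P k' p := by
  have : k = k' := funext fun p => propext (h p)
  simp [this]

/-- The pullbacks evaluate the final predicate only at assignments defined on `D` and the prefix
variables. In the induction `D` grows by the variable of the head quantifier. -/
theorem prefixEval_congr_pred (P : List (Quantifier V)) {D : Set V}
    {k : (Asg V A → Prop) → Prop}
    (hk : ∀ p q : Asg V A → Prop, (∀ χ, pdom χ = D → (p χ ↔ q χ)) → (k p ↔ k q))
    {p q : Asg V A → Prop} (h : ∀ χ, pdom χ = D ∪ prefixVars P → (p χ ↔ q χ)) :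
    prefixEval P k p ↔ prefixEval P k q := by
  induction P generalizing D k with
  | nil => exact hk p q fun χ hχ => h χ (by simp [prefixVars, hχ])
  | cons r P ih =>
    refine ih (D := insert r.bound D) (fun p q hpq => ?_) fun χ hχ => h χ ?_
    · refine r.functions_congr fun f _ => hk _ _ fun χ hχ => hpq _ ?_
      rw [pdom_pupdate, hχ]
    · rw [hχ]
      ext y
      simp only [prefixVars, List.mem_cons, exists_eq_or_imp, Set.mem_union, Set.mem_insert_iff,
        Set.mem_ofPred_eq, eq_comm (a := y)]
      tauto

/-- A prenex formula is evaluated by quantifying over functions, innermost quantifier first. -/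
theorem sat_withQuantifiers_iff {φ : Formula L V} {F : FunAsg V A} {p : Asg V A → Prop}
    (h : ∀ X α, Sat φ F X α ↔ atomSat p X α) (P : List (Quantifier V))
    (X : Hyperteam V A) (α : Flag) :
    Sat (Formula.withQuantifiers P φ) F X α ↔ prefixEval P (fun p => atomSat p X α) p := by
  induction P generalizing X α with
  | nil => exact h X α
  | cons q P ih =>
    cases q with
    | ex c x =>
      cases α with
      | EA => exact (ih _ _).trans (prefixEval_congr P (fun _ => atomSat_ext_EA _ _) p)
      | AE =>
        refine (ih (X.dual.ext c.denote x) .EA).trans (prefixEval_congr P (fun r => ?_) p)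
        rw [atomSat_ext_EA]
        exact exists_congr fun f => and_congr_right fun _ => atomSat_dual _ X .EA
    | all c x =>
      cases α with
      | EA =>
        refine (ih (X.dual.ext c.denote x) .AE).trans (prefixEval_congr P (fun r => ?_) p)
        rw [atomSat_ext_AE]
        exact forall_congr' fun f => forall_congr' fun _ => atomSat_dual _ X .AE
      | AE => exact (ih _ _).trans (prefixEval_congr P (fun _ => atomSat_ext_AE _ _) p)

/-! ### Meta quantifiers and the function assignment -/

/-- Storing a function in the function assignment has the same effect as first extending the
assignment by its value. -/
theorem IsExtension.of_pupdate {F : FunAsg V A} {W : Set V} {x : V} {f : Fnc V A}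
    (hf : Uniform W f) (hx : x ∉ W) (hW : ∀ y ∈ W, y ∉ pdom F) {χ χ' : Asg V A}
    (hχ : x ∉ pdom χ) (h : IsExtension (pupdate F x f) χ χ') :
    IsExtension F (pupdate χ x (f χ)) χ' := by
  obtain ⟨hdom, hin, hout⟩ := h
  rw [pdom_pupdate] at hdom
  -- The crux: a variable of `W` undefined in `χ` stays undefined in `χ'`, being neither `x` nor in
  -- `pdom F`. So `f` cannot tell `χ` from `χ'`.
  have hfx : f χ' = f χ := by
    refine hf.congr fun y hy => ?_
    by_cases hyχ : y ∈ pdom χ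
    · exact hin y hyχ
    · have hyx : y ≠ x := fun h => hx (h ▸ hy)
      have n : y ∉ pdom χ' := by rw [hdom]; simp [hyχ, hyx, hW y hy]
      rw [mem_pdom, not_not] at n hyχ
      rw [n, hyχ]
  refine ⟨?_, fun y hy => ?_, fun y g hy hg => ?_⟩
  · rw [hdom, pdom_pupdate, Set.union_insert, Set.insert_union]
  · by_cases hyx : y = x
    · subst hyx
      rw [pupdate_self, hout y f hχ (pupdate_self _ _ _), hfx]
    · rw [pdom_pupdate] at hy
      rw [pupdate_of_ne _ _ hyx, hin y (hy.resolve_left hyx)]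
  · rw [pdom_pupdate, Set.mem_insert_iff, not_or] at hy
    exact hout y g hy.2 (by rw [pupdate_of_ne _ _ hy.1, hg])

/-- The Herbrand-Skolem prefix is evaluated by the same function quantifications. -/
theorem sat_hsp_iff {φ : Formula L V} (hφ : φ.QuantifierFree) (P : List (Quantifier V))
    (hP : IsQuantifierPrefix P) {F : FunAsg V A} (hF : F.Acyclic)
    (hFP : pdom F ∩ prefixDeps P = ∅) {e : Asg V A → Asg V A}
    (he : ∀ χ χ', IsExtension F χ χ' ↔ χ' = e χ) {U : Set V} {X : Hyperteam V A}
    (hX : IsHyperteam U X) (hUP : U ∩ prefixVars P = ∅) (α : Flag) :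
    Sat (Formula.withMetaQuantifiers (hsp P) φ) F X α ↔
      prefixEval P (fun p => atomSat p X α) (fun χ => φ.Holds (e χ)) := by
  -- The last quantifier of `P` is the outermost in `hsp P`. Peeling it off changes `F` and `e` but
  -- leaves `X` fixed.
  induction P using List.reverseRecOn generalizing F e with
  | nil => exact sat_iff_atomSat_holds hφ he X α
  | append_singleton P q ih =>
    obtain ⟨hnodup, hself, hinner⟩ := hP
    rw [List.map_append, List.nodup_append] at hnodup
    rw [List.pairwise_append] at hinner
    have hqx : q.bound ∉ q.deps := hself q (by simp)
    have hqF : ∀ y ∈ q.deps, y ∉ pdom F := fun y hy hyF =>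
      Set.eq_empty_iff_forall_notMem.1 hFP y ⟨hyF, q, by simp, hy⟩
    have hqP : q.bound ∉ prefixVars P := by
      rintro ⟨r, hr, hrq⟩
      exact hnodup.2.2 _ (List.mem_map_of_mem hr) _ (by simp) hrq
    have hqU : q.bound ∉ U := fun h =>
      Set.eq_empty_iff_forall_notMem.1 hUP _ ⟨h, q, by simp, rfl⟩
    have unfold : Sat (Formula.withMetaQuantifiers (hsp (P ++ [q])) φ) F X α ↔
        q.functions fun f =>
          Sat (Formula.withMetaQuantifiers (hsp P) φ) (pupdate F q.bound f) X α := by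
      have : hsp (P ++ [q]) = q.toMeta :: hsp P := by simp [hsp]
      rw [this]
      cases q <;> cases α <;> rfl
    rw [unfold, prefixEval_concat]
    refine q.functions_congr fun f hf => ?_
    have hF' : FunAsg.Acyclic (pupdate F q.bound f) := hF.pupdate hf hqx hqF
    obtain ⟨e', he'⟩ := hF'.exists_extension
    rw [ih ⟨hnodup.1, fun r hr => hself r (List.mem_append_left _ hr), hinner.1⟩ hF' ?_ he' ?_]
    · refine prefixEval_congr_pred P (D := U) (fun _ _ h => atomSat_congr hX h α) fun χ hχ => ?_
      -- Here `χ` has domain `U ∪ prefixVars P`, which misses `q.bound` because the prefix binds no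
      -- variable twice and none of `U`.
      have : e' χ = e (pupdate χ q.bound (f χ)) :=
        (he _ _).1 (((he' _ _).2 rfl).of_pupdate hf hqx hqF (by rw [hχ]; simp [hqU, hqP]))
      rw [this]
    · rw [Set.eq_empty_iff_forall_notMem, pdom_pupdate]
      rintro y ⟨rfl | hyF, r, hr, hy⟩
      -- Prefix condition (iii): an outer quantifier `r` may not depend on the variable just added
      -- to the domain.
      · exact hinner.2.2 r hr q (by simp) hy
      · exact Set.eq_empty_iff_forall_notMem.1 hFP y ⟨hyF, r, List.mem_append_left _ hr, hy⟩
    · rw [Set.eq_empty_iff_forall_notMem]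
      rintro y ⟨hyU, r, hr, hy⟩
      exact Set.eq_empty_iff_forall_notMem.1 hUP y ⟨hyU, r, List.mem_append_left _ hr, hy⟩

end Formulae

end ADIF

theorem mainTheorem4 {L : FirstOrder.Language} [L.IsRelational]
    {V A : Type*} [L.Structure A]
    (P : List (ADIF.Quantifier V)) (hP : ADIF.IsQuantifierPrefix P)
    (φ : ADIF.Formula L V) (hφ : φ.QuantifierFree)
    (F : ADIF.FunAsg V A) (hF : F.Acyclic) (hFP : ADIF.pdom F ∩ ADIF.prefixDeps P = ∅)
    (U : Set V) (X : ADIF.Hyperteam V A) (hX : ADIF.IsHyperteam U X)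
    (hU : (ADIF.Formula.withQuantifiers P φ).sup \ ADIF.pdom F ⊆ U)
    (hUP : U ∩ ADIF.prefixVars P = ∅) (α : ADIF.Flag) :
    ADIF.Sat (ADIF.Formula.withQuantifiers P φ) F X α ↔
      ADIF.Sat (ADIF.Formula.withMetaQuantifiers (ADIF.hsp P) φ) F X α := by
  obtain ⟨e, he⟩ := hF.exists_extension
  rw [ADIF.sat_withQuantifiers_iff (ADIF.sat_iff_atomSat_holds hφ he) P X α,
    ADIF.sat_hsp_iff hφ P hP hF hFP he hX hUP α]
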